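/- Let $\mathbb{H}^3$ be hyperbolic 3-space. A spin decoration $W=(W^{in},W^{out})$ on a horosphere $H$ consists of continuous lifts $W^{in}, W^{out}$, to the spin double cover of the bundle of right-handed orthonormal frames of $\mathbb{H}^3$, of the inward frame field $(N^{in}, v, N^{in}\times v)$ and the outward frame field $(N^{out}, v, N^{out}\times v)$ of a unit parallel tangent vector field $v$ on $H$, where $N^{out}$ and $N^{in}=-N^{out}$ are the unit normals towards and away from the centre of $H$, such that rotating $W^{out}$ by $\pi$ about $v$ at each point of $H$ yields $W^{in}$. For spin-decorated horospheres $(H_i,W_i)$, $(H_j,W_j)$ with distinct centres $z_i, z_j \in \partial\mathbb{H}^3$, let $\gamma$ be the oriented geodesic from $z_i$ to $z_j$, let $p_i=\gamma\cap H_i$ and $p_j=\gamma\cap H_j$, and let $d=\rho+i\theta$ be the complex distance from $W_i^{in}(p_i)$ to $W_j^{out}(p_j)$: a translation along $\gamma$ of signed distance $\rho$ followed by a rotation about $\gamma$ of angle $\theta$ takes the first spin frame to the second, so that $d$ is well defined modulo $4\pi i$. The complex lambda length from $(H_i,W_i)$ to $(H_j,W_j)$ is $\lambda_{ij}=\exp(d/2)$;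 it is $0$ if the centres agree. **Theorem.** Let $z_0,z_1,z_2,z_3$ be the vertices of a spin-decorated ideal tetrahedron, i.e. four distinct points of $\partial\mathbb{H}^3$ with a spin-decorated horosphere $(H_i,W_i)$ centred at each $z_i$. Then the complex lambda lengths $\lambda_{ij}$ from $(H_i,W_i)$ to $(H_j,W_j)$ are well-defined complex numbers, and $$\lambda_{01}\lambda_{23}+\lambda_{03}\lambda_{12}=\lambda_{02}\lambda_{13}.$$ -/

import Mathlib

open scoped Topology

noncomputable section

namespace SpinHorosphere

/-! ### Minkowski space, the hyperboloid model and ideal points -/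

/-- Minkowski space `ℝ^{1,3}`; the coordinates `0, 1, 2, 3` are `T, X, Y, Z`. -/
abbrev Minkowski : Type := Fin 4 → ℝ

/-- The Lorentzian metric `dT² - dX² - dY² - dZ²`. -/
def mink (x y : Minkowski) : ℝ := x 0 * y 0 - x 1 * y 1 - x 2 * y 2 - x 3 * y 3

/-- Hyperbolic 3-space, in the hyperboloid model. Its tangent space at `p` is the orthogonal
complement of `p`, with the Riemannian metric `-mink`, and it is oriented so that
`∂X, ∂Y, ∂Z` is right-handed at `(1, 0, 0, 0)`. -/
def hyperbolicSpace : Set Minkowski := {x | mink x x = 1 ∧ 0 < x 0}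

/-- The future light cone. -/
def lightCone : Set Minkowski := {x | mink x x = 0 ∧ 0 < x 0}

/-- The boundary at infinity of hyperbolic space, i.e. the set of rays of the future light cone,
each represented by its point with `T = 1`. -/
def celestialSphere : Set Minkowski := {x | x ∈ lightCone ∧ x 0 = 1}

/-- The signs of the Lorentzian metric. -/
def minkSign : Fin 4 → ℝ := ![1, -1, -1, -1]

/-- The cross product of two vectors `v, w` tangent to hyperbolic space at `q`: the vector with
`-mink (cross q v w) x = det (q, v, w, x)` for all `x`. -/
def cross (q v w : Minkowski) : Minkowski := fun i =>
  -(minkSign i) * (Matrix.of ![q, v, w, Pi.single i 1]).det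

/-! ### The action of `SL(2, ℂ)` -/

/-- `SL(2, ℂ)`. -/
abbrev SL2C : Type := Matrix.SpecialLinearGroup (Fin 2) ℂ

/-- The Hermitian matrix of a point of Minkowski space. -/
def toHermitian (x : Minkowski) : Matrix (Fin 2) (Fin 2) ℂ :=
  (1 / 2 : ℂ) • !![(x 0 + x 3 : ℂ), x 1 + x 2 * Complex.I; x 1 - x 2 * Complex.I, x 0 - x 3]

/-- The point of Minkowski space of a Hermitian matrix. -/
def ofHermitian (S : Matrix (Fin 2) (Fin 2) ℂ) : Minkowski :=
  ![(S 0 0 + S 1 1).re, 2 * (S 0 1).re, 2 * (S 0 1).im, (S 0 0 - S 1 1).re]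

/-- The action of `SL(2, ℂ)` on Minkowski space, `A.S = A S A*` on Hermitian matrices. On
hyperbolic space it is the action by orientation-preserving isometries. -/
def act (A : SL2C) (x : Minkowski) : Minkowski :=
  ofHermitian ((A : Matrix (Fin 2) (Fin 2) ℂ) * toHermitian x *
    (A : Matrix (Fin 2) (Fin 2) ℂ).conjTranspose)

/-! ### Frames -/

/-- A point together with three vectors. -/
@[ext] structure Triad where
  pt : Minkowski
  f₁ : Minkowski
  f₂ : Minkowski
  f₃ : Minkowski

namespace Triad

/-- `F` is a frame: a right-handed orthonormal frame at a point of hyperbolic space. -/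
structure IsFrame (F : Triad) : Prop where
  pt_mem : F.pt ∈ hyperbolicSpace
  tangent₁ : mink F.pt F.f₁ = 0
  tangent₂ : mink F.pt F.f₂ = 0
  tangent₃ : mink F.pt F.f₃ = 0
  unit₁ : mink F.f₁ F.f₁ = -1
  unit₂ : mink F.f₂ F.f₂ = -1
  unit₃ : mink F.f₃ F.f₃ = -1
  orth₁₂ : mink F.f₁ F.f₂ = 0
  orth₁₃ : mink F.f₁ F.f₃ = 0
  orth₂₃ : mink F.f₂ F.f₃ = 0
  cross_eq : cross F.pt F.f₁ F.f₂ = F.f₃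

/-- Right-handed rotation by the angle `θ` about the unit tangent vector `v` at `p`, on the tangent
space at `p` (where the Riemannian inner product is `-mink`). -/
def rotateVec (p v : Minkowski) (θ : ℝ) (w : Minkowski) : Minkowski :=
  Real.cos θ • w + Real.sin θ • cross p v w + ((1 - Real.cos θ) * (-mink v w)) • v

/-- The frame `F` rotated by the angle `θ` about the unit tangent vector `v` at its point. -/
def rotate (F : Triad) (v : Minkowski) (θ : ℝ) : Triad where
  pt := F.pt
  f₁ := rotateVec F.pt v θ F.f₁
  f₂ := rotateVec F.pt v θ F.f₂
  f₃ := rotateVec F.pt v θ F.f₃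

/-- The frame `F` parallel translated by the signed distance `s` along the geodesic
`t ↦ cosh t • pt + sinh t • f₁` through its point in the direction of its first vector. Vectors
orthogonal to the plane of the geodesic are constant under parallel translation. -/
def translate (F : Triad) (s : ℝ) : Triad where
  pt := Real.cosh s • F.pt + Real.sinh s • F.f₁
  f₁ := Real.sinh s • F.pt + Real.cosh s • F.f₁
  f₂ := F.f₂
  f₃ := F.f₃

end Triad

/-! ### Spin frames

The group `PSL(2, ℂ)` acts simply transitively on frames. The spin double cover (which is the
universal cover) of the bundle of frames is therefore `SL(2, ℂ)`, with the covering map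
`A ↦ A.F₀`, for a base frame `F₀`. -/

/-- The space of spin frames, with the topology of `SL(2, ℂ)`. -/
abbrev SpinFrame : Type := SL2C

/-- The base frame: `(∂Z, ∂Y, -∂X)` at the point `(1, 0, 0, 0)`. Another choice gives an isomorphic
covering. -/
def baseFrame : Triad where
  pt := ![1, 0, 0, 0]
  f₁ := ![0, 0, 0, 1]
  f₂ := ![0, 0, 1, 0]
  f₃ := ![0, -1, 0, 0]

/-- The covering map from spin frames to frames. -/
def frameOf (A : SpinFrame) : Triad where
  pt := act A baseFrame.pt
  f₁ := act A baseFrame.f₁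
  f₂ := act A baseFrame.f₂
  f₃ := act A baseFrame.f₃

/-- Rotating the spin frame `A` by the angle `θ` about the unit tangent vector `v` yields the spin
frame `B`: lift the path of rotated frames, starting at `A`. -/
def IsRotation (A : SpinFrame) (v : Minkowski) (θ : ℝ) (B : SpinFrame) : Prop :=
  ∃ γ : ℝ → SpinFrame, Continuous γ ∧ γ 0 = A ∧
    (∀ t, frameOf (γ t) = (frameOf A).rotate v t) ∧ γ θ = B

/-- Translating the spin frame `A` by the signed distance `s` along the geodesic in the direction
of its first vector yields the spin frame `B`: lift the path of translated frames. -/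
def IsTranslation (A : SpinFrame) (s : ℝ) (B : SpinFrame) : Prop :=
  ∃ γ : ℝ → SpinFrame, Continuous γ ∧ γ 0 = A ∧
    (∀ t, frameOf (γ t) = (frameOf A).translate t) ∧ γ s = B

/-! ### Horospheres and spin decorations -/

/-- A horosphere, given by the unique point `p` of the future light cone such that its points are
the `x` in hyperbolic space with `⟨x, p⟩ = 1`. -/
structure Horosphere where
  normal : Minkowski
  normal_mem : normal ∈ lightCone

namespace Horosphere

variable (H : Horosphere)

/-- The points of the horosphere. -/
def points : Set Minkowski := {x | x ∈ hyperbolicSpace ∧ mink x H.normal = 1}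

/-- The centre of the horosphere, i.e. its point at infinity. -/
def centre : Minkowski := (H.normal 0)⁻¹ • H.normal

/-- The outward unit normal at `q`, which points towards the centre: the geodesic
`cosh t • q + sinh t • (p - q) = exp (-t) • q + sinh t • p` tends to the ray of `p`. -/
def outwardNormal (q : Minkowski) : Minkowski := H.normal - q

/-- The inward unit normal at `q`. -/
def inwardNormal (q : Minkowski) : Minkowski := q - H.normal

/-- `v` is a unit tangent vector field on `H` which is parallel, i.e. invariant under all parabolic
isometries that preserve `H`. -/
structure IsParallelUnitField (v : H.points → Minkowski) : Prop where
  tangent : ∀ q, mink (v q) q = 0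
  tangent_horosphere : ∀ q, mink (v q) H.normal = 0
  unit : ∀ q, mink (v q) (v q) = -1
  parallel : ∀ A : SL2C, (A : Matrix (Fin 2) (Fin 2) ℂ).IsParabolic →
    act A '' H.points = H.points →
      ∀ q q' : H.points, (q' : Minkowski) = act A q → v q' = act A (v q)

/-- The outward frame field `(N, v, N × v)`, with `N` the outward normal. -/
def outwardFrame (v : H.points → Minkowski) (q : H.points) : Triad where
  pt := q
  f₁ := H.outwardNormal q
  f₂ := v q
  f₃ := cross q (H.outwardNormal q) (v q)

/-- The inward frame field `(N, v, N × v)`, with `N` the inward normal. -/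
def inwardFrame (v : H.points → Minkowski) (q : H.points) : Triad where
  pt := q
  f₁ := H.inwardNormal q
  f₂ := v q
  f₃ := cross q (H.inwardNormal q) (v q)

end Horosphere

/-- A spin decoration on `H`: a parallel unit tangent vector field `v` with continuous lifts
of its inward and outward frame fields to spin frames, associated to each other: rotating the
outward one by `π` about `v` yields the inward one. -/
structure SpinDecoration (H : Horosphere) where
  v : H.points → Minkowski
  isParallel : H.IsParallelUnitField v
  inward : H.points → SpinFrame
  outward : H.points → SpinFrame
  continuous_inward : Continuous inward
  continuous_outward : Continuous outward
  lift_inward : ∀ q, frameOf (inward q) = H.inwardFrame v q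
  lift_outward : ∀ q, frameOf (outward q) = H.outwardFrame v q
  associated : ∀ q, IsRotation (outward q) (v q) Real.pi (inward q)

/-- A spin-decorated horosphere. -/
structure SpinDecoratedHorosphere where
  H : Horosphere
  W : SpinDecoration H

/-! ### Complex distance and complex lambda length -/

/-- An oriented geodesic of hyperbolic space, given by a unit speed parametrisation, with initial
point `base` and initial velocity `dir`. -/
structure OrientedGeodesic where
  base : Minkowski
  dir : Minkowski
  base_mem : base ∈ hyperbolicSpace
  tangent : mink base dir = 0
  unit : mink dir dir = -1

namespace OrientedGeodesic

variable (γ : OrientedGeodesic)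

/-- The point of the geodesic at time `t`. -/
def point (t : ℝ) : Minkowski := Real.cosh t • γ.base + Real.sinh t • γ.dir

/-- The velocity of the geodesic at time `t`. -/
def velocity (t : ℝ) : Minkowski := Real.sinh t • γ.base + Real.cosh t • γ.dir

/-- The geodesic runs from the ideal point `z` to the ideal point `w`. -/
def RunsFromTo (z w : Minkowski) : Prop :=
  Filter.Tendsto (fun t => (γ.point t 0)⁻¹ • γ.point t) Filter.atBot (𝓝 z) ∧
    Filter.Tendsto (fun t => (γ.point t 0)⁻¹ • γ.point t) Filter.atTop (𝓝 w)

/-- The frame `F` is adapted to the oriented geodesic. -/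
def Adapted (F : Triad) : Prop := ∃ t, F.pt = γ.point t ∧ F.f₁ = γ.velocity t

end OrientedGeodesic

/-- `d = ρ + i θ` is a complex distance from `A` to `B`, spin frames adapted to the oriented
geodesic `γ`: translating `A` by the signed distance `ρ` along `γ`, and then rotating by the angle
`θ` about `γ`, yields `B`. -/
def IsComplexDistance (γ : OrientedGeodesic) (A B : SpinFrame) (d : ℂ) : Prop :=
  γ.Adapted (frameOf A) ∧ γ.Adapted (frameOf B) ∧
    ∃ C : SpinFrame, IsTranslation A d.re C ∧ IsRotation C (frameOf C).f₁ d.im B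

/-- `z` is a complex lambda length from `S₁` to `S₂`: zero if the centres agree; otherwise
`exp (d / 2)`, where `d` is a complex distance from the inward spin frame of `S₁` to the outward
spin frame of `S₂` at their points on the geodesic from the centre of `S₁` to that of `S₂`. -/
def IsComplexLambdaLength (S₁ S₂ : SpinDecoratedHorosphere) (z : ℂ) : Prop :=
  (S₁.H.centre = S₂.H.centre ∧ z = 0) ∨
    (S₁.H.centre ≠ S₂.H.centre ∧
      ∃ (γ : OrientedGeodesic) (p₁ : S₁.H.points) (p₂ : S₂.H.points) (d : ℂ),
        γ.RunsFromTo S₁.H.centre S₂.H.centre ∧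
        (p₁ : Minkowski) ∈ Set.range γ.point ∧ (p₂ : Minkowski) ∈ Set.range γ.point ∧
        IsComplexDistance γ (S₁.W.inward p₁) (S₂.W.outward p₂) d ∧
        z = Complex.exp (d / 2))

/-- A spin-decorated ideal tetrahedron: four distinct ideal points, labelled `0, 1, 2, 3`, and a
spin-decorated horosphere centred at each of them. -/
structure SpinDecoratedIdealTetrahedron where
  vertex : Fin 4 → Minkowski
  vertex_mem : ∀ i, vertex i ∈ celestialSphere
  vertex_injective : Function.Injective vertex
  horosphere : Fin 4 → SpinDecoratedHorosphere
  centre_eq : ∀ i, (horosphere i).H.centre = vertex i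

/-! ### The covering map takes values in frames and is two-to-one -/

/-- The entries of a matrix of `SL(2, ℂ)`, in real coordinates, and its determinant. -/
theorem exists_real_entries (A : SL2C) : ∃ a b c d e f g h : ℝ,
    (A : Matrix (Fin 2) (Fin 2) ℂ) = !![⟨a, b⟩, ⟨c, d⟩; ⟨e, f⟩, ⟨g, h⟩] ∧
    a * g - b * h - (c * e - d * f) = 1 ∧ a * h + b * g - (c * f + d * e) = 0 := by
  refine ⟨(A.1 0 0).re, (A.1 0 0).im, (A.1 0 1).re, (A.1 0 1).im, (A.1 1 0).re, (A.1 1 0).im,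
    (A.1 1 1).re, (A.1 1 1).im, ?_, ?_, ?_⟩
  · ext i j
    fin_cases i <;> fin_cases j <;> rfl
  · have h := congrArg Complex.re A.2
    rw [Matrix.det_fin_two] at h
    simpa using h
  · have h := congrArg Complex.im A.2
    rw [Matrix.det_fin_two] at h
    simpa using h

/-- The action in real coordinates. -/
theorem act_eq (A : SL2C) {a b c d e f g h : ℝ}
    (hA : (A : Matrix (Fin 2) (Fin 2) ℂ) = !![⟨a, b⟩, ⟨c, d⟩; ⟨e, f⟩, ⟨g, h⟩]) (v : Minkowski) :
    act A v =
      v 0 • ![(a ^ 2 + b ^ 2 + c ^ 2 + d ^ 2 + e ^ 2 + f ^ 2 + g ^ 2 + h ^ 2) / 2,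
        a * e + b * f + c * g + d * h, b * e - a * f + d * g - c * h,
        (a ^ 2 + b ^ 2 + c ^ 2 + d ^ 2 - e ^ 2 - f ^ 2 - g ^ 2 - h ^ 2) / 2] +
      v 1 • ![a * c + b * d + e * g + f * h, a * g + b * h + c * e + d * f,
        b * g - a * h + d * e - c * f, a * c + b * d - e * g - f * h] +
      v 2 • ![a * d - b * c + e * h - f * g, a * h - b * g - c * f + d * e,
        a * g + b * h - c * e - d * f, a * d - b * c - e * h + f * g] +
      v 3 • ![(a ^ 2 + b ^ 2 - c ^ 2 - d ^ 2 + e ^ 2 + f ^ 2 - g ^ 2 - h ^ 2) / 2,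
        a * e + b * f - c * g - d * h, b * e - a * f - d * g + c * h,
        (a ^ 2 + b ^ 2 - c ^ 2 - d ^ 2 - e ^ 2 - f ^ 2 + g ^ 2 + h ^ 2) / 2] := by
  ext i
  fin_cases i <;> simp [act, hA, ofHermitian, toHermitian, Matrix.mul_apply,
      Fin.sum_univ_two, Matrix.conjTranspose_apply] <;> ring

/-- The covering map takes values in frames. -/
theorem frameOf_isFrame (A : SpinFrame) : (frameOf A).IsFrame := by
  obtain ⟨a, b, c, d, e, f, g, h, hA, h1, h2⟩ := exists_real_entries A
  have key : (a * g - b * h - (c * e - d * f)) ^ 2 + (a * h + b * g - (c * f + d * e)) ^ 2 = 1 := by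
    rw [h1, h2]; norm_num
  refine ⟨⟨?_, ?_⟩, ?_, ?_, ?_, ?_, ?_, ?_, ?_, ?_, ?_, ?_⟩
  case refine_2 =>
    simp only [frameOf, baseFrame, act_eq A hA]
    simp
    by_contra! hn
    have ha : a = 0 := by nlinarith [sq_nonneg a, sq_nonneg b, sq_nonneg c, sq_nonneg d, sq_nonneg e, sq_nonneg f, sq_nonneg g, sq_nonneg h]
    have hb : b = 0 := by nlinarith [sq_nonneg a, sq_nonneg b, sq_nonneg c, sq_nonneg d, sq_nonneg e, sq_nonneg f, sq_nonneg g, sq_nonneg h]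
    have hc : c = 0 := by nlinarith [sq_nonneg a, sq_nonneg b, sq_nonneg c, sq_nonneg d, sq_nonneg e, sq_nonneg f, sq_nonneg g, sq_nonneg h]
    have hd : d = 0 := by nlinarith [sq_nonneg a, sq_nonneg b, sq_nonneg c, sq_nonneg d, sq_nonneg e, sq_nonneg f, sq_nonneg g, sq_nonneg h]
    simp [ha, hb, hc, hd] at h1
  case refine_12 =>
    funext i
    have hi : ∀ x : ℝ, ((a * g - b * h - (c * e - d * f)) ^ 2 +
        (a * h + b * g - (c * f + d * e)) ^ 2) * x = x := fun x => by rw [key, one_mul]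
    rw [← hi ((frameOf A).f₃ i)]
    fin_cases i <;>
    · simp [cross, frameOf, baseFrame, act_eq A hA, minkSign, Matrix.det_succ_row_zero,
        Fin.sum_univ_succ, Fin.succAbove]
      ring
  all_goals
    simp only [frameOf, baseFrame, act_eq A hA, mink]
    simp
    first
      | ring1
      | linear_combination key
      | linear_combination -key

theorem eq_or_eq_neg_of_mul_conj {x y : Fin 4 → ℂ}
    (hxy : ∀ i j, x i * (starRingEnd ℂ) (x j) = y i * (starRingEnd ℂ) (y j))
    (hx : x 0 * x 3 - x 1 * x 2 = 1) (hy : y 0 * y 3 - y 1 * y 2 = 1) : x = y ∨ x = -y := by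
  set w : ℂ := ∑ k, (starRingEnd ℂ) (x k) * y k with hw
  set n : ℂ := ∑ k, (starRingEnd ℂ) (y k) * y k with hn
  have h : ∀ j, w * x j = n * y j := fun j => by
    rw [hw, hn, Finset.sum_mul, Finset.sum_mul]
    refine Finset.sum_congr rfl fun k _ => ?_
    linear_combination y k * hxy j k
  have hn0 : n ≠ 0 := by
    intro h0
    have h1 : (∑ k, Complex.normSq (y k) : ℝ) = 0 := by
      have : ((∑ k, Complex.normSq (y k) : ℝ) : ℂ) = 0 := by
        rw [← h0, hn, Complex.ofReal_sum]
        exact Finset.sum_congr rfl fun k _ => Complex.normSq_eq_conj_mul_self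
      exact_mod_cast this
    have h2 : ∀ k, y k = 0 := fun k => Complex.normSq_eq_zero.1
      ((Finset.sum_eq_zero_iff_of_nonneg fun i _ => Complex.normSq_nonneg (y i)).1 h1 k
        (Finset.mem_univ k))
    simp [h2] at hy
  have hsq : w ^ 2 = n ^ 2 := by
    linear_combination (-(w ^ 2)) * hx + n ^ 2 * hy + w * x 3 * h 0 + n * y 0 * h 3 -
      w * x 2 * h 1 - n * y 1 * h 2
  rcases sq_eq_sq_iff_eq_or_eq_neg.1 hsq with h1 | h1
  · left
    funext j
    have := h j
    rw [h1] at this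
    exact mul_left_cancel₀ hn0 this
  · right
    funext j
    have := h j
    rw [h1] at this
    apply mul_left_cancel₀ hn0
    rw [Pi.neg_apply]
    linear_combination -this

/-- The fibres of the covering map are the pairs `{A, -A}`. -/
theorem frameOf_eq_iff (A B : SpinFrame) : frameOf A = frameOf B ↔ A = B ∨ A = -B := by
  constructor
  · intro hAB
    obtain ⟨a, b, c, d, e, f, g, h, hA, -, -⟩ := exists_real_entries A
    obtain ⟨a', b', c', d', e', f', g', h', hB, -, -⟩ := exists_real_entries B
    have k0 := congrArg Triad.pt hAB
    have k1 := congrArg Triad.f₁ hAB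
    have k2 := congrArg Triad.f₂ hAB
    have k3 := congrArg Triad.f₃ hAB
    simp only [frameOf, baseFrame, act_eq A hA, act_eq B hB] at k0 k1 k2 k3
    have k00 := congrFun k0 0
    have k01 := congrFun k0 1
    have k02 := congrFun k0 2
    have k03 := congrFun k0 3
    have k10 := congrFun k1 0
    have k11 := congrFun k1 1
    have k12 := congrFun k1 2
    have k13 := congrFun k1 3
    have k20 := congrFun k2 0
    have k21 := congrFun k2 1
    have k22 := congrFun k2 2
    have k23 := congrFun k2 3
    have k30 := congrFun k3 0
    have k31 := congrFun k3 1
    have k32 := congrFun k3 2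
    have k33 := congrFun k3 3
    clear hAB k0 k1 k2 k3
    simp at k00 k01 k02 k03 k10 k11 k12 k13 k20 k21 k22 k23 k30 k31 k32 k33
    have dA := A.2
    have dB := B.2
    rw [Matrix.det_fin_two, hA] at dA
    rw [Matrix.det_fin_two, hB] at dB
    have := eq_or_eq_neg_of_mul_conj (x := ![⟨a, b⟩, ⟨c, d⟩, ⟨e, f⟩, ⟨g, h⟩])
      (y := ![⟨a', b'⟩, ⟨c', d'⟩, ⟨e', f'⟩, ⟨g', h'⟩])
      (fun i j => by
        fin_cases i <;> fin_cases j <;> apply Complex.ext <;> simp <;> linarith)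
      (by simpa using dA) (by simpa using dB)
    rcases this with h1 | h1
    · left
      apply Subtype.ext
      rw [hA, hB]
      have := congrFun h1
      ext i j
      fin_cases i <;> fin_cases j
      exacts [this 0, this 1, this 2, this 3]
    · right
      apply Subtype.ext
      rw [Matrix.SpecialLinearGroup.coe_neg, hA, hB]
      have := congrFun h1
      ext i j
      fin_cases i <;> fin_cases j
      exacts [this 0, this 1, this 2, this 3]
  · rintro (rfl | rfl)
    · rfl
    · ext i <;> simp [frameOf, act]

end SpinHorosphere

end

noncomputable section

namespace SpinHorosphere

/-! ### Linearity and multiplicativity of the action -/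

/-! Spin frames are elements of `SL2C`, and moving a frame relative to itself is right
multiplication. Translation and rotation along the first vector become `diagExp`, and the half turn
relating outward to inward frames becomes `rotY Real.pi`. Unique lifting to the double cover makes
these identities exact, with no sign ambiguity.

Parabolic invariance of the field and continuity of the lift force the outward spin frames of a
decoration to form one coset `A * upper z`, `z : ℂ` (`SpinDecoration.exists_outward_eq`). What the
coset retains is the first column of `A`, the spinor of the decoration.

For decorations with cosets of `A` and `B`, a complex distance `d` satisfies `B * upper w = A *
upper z * rotY Real.pi * diagExp (d / 2)`. This is the Bruhat decomposition of `A⁻¹ * B`, so `exp (d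
/ 2)` is the lower left entry of `A⁻¹ * B`, that is, the determinant of the two spinors
(`isComplexLambdaLength_iff`, `inv_mul_apply_one_zero`). Ptolemy's equation is then the Plücker
relation for four vectors of `ℂ²`. -/

theorem act_add (A : SL2C) (x y : Minkowski) : act A (x + y) = act A x + act A y := by
  obtain ⟨a, b, c, d, e, f, g, h, hA, -, -⟩ := exists_real_entries A
  simp only [act_eq A hA, Pi.add_apply]
  module

theorem act_smul (A : SL2C) (r : ℝ) (x : Minkowski) : act A (r • x) = r • act A x := by
  obtain ⟨a, b, c, d, e, f, g, h, hA, -, -⟩ := exists_real_entries A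
  simp only [act_eq A hA, Pi.smul_apply, smul_eq_mul]
  module

theorem act_neg (A : SL2C) (x : Minkowski) : act A (-x) = -act A x := by
  rw [← neg_one_smul ℝ x, act_smul, neg_one_smul]

theorem act_sub (A : SL2C) (x y : Minkowski) : act A (x - y) = act A x - act A y := by
  rw [sub_eq_add_neg, act_add, act_neg, ← sub_eq_add_neg]

theorem toHermitian_isHermitian (x : Minkowski) : (toHermitian x).IsHermitian := by
  ext i j
  fin_cases i <;> fin_cases j <;> apply Complex.ext <;>
    simp [toHermitian, Matrix.conjTranspose_apply]

theorem toHermitian_ofHermitian {S : Matrix (Fin 2) (Fin 2) ℂ} (hS : S.IsHermitian) :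
    toHermitian (ofHermitian S) = S := by
  have h00 := congrArg Complex.im (hS.apply 0 0)
  have h11 := congrArg Complex.im (hS.apply 1 1)
  have h01 := hS.apply 1 0
  have hre := congrArg Complex.re h01
  have him := congrArg Complex.im h01
  simp at h00 h11 hre him
  ext i j
  fin_cases i <;> fin_cases j <;> apply Complex.ext <;>
    simp [toHermitian, ofHermitian] <;> linarith

/-- Conjugation keeps the matrix Hermitian, so `ofHermitian` loses nothing. Multiplicativity and
invariance of `mink` can therefore be read off from matrices. -/
theorem toHermitian_act (A : SL2C) (x : Minkowski) :
    toHermitian (act A x) = (A : Matrix (Fin 2) (Fin 2) ℂ) * toHermitian x *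
      (A : Matrix (Fin 2) (Fin 2) ℂ).conjTranspose :=
  toHermitian_ofHermitian
    (Matrix.isHermitian_mul_mul_conjTranspose _ (toHermitian_isHermitian x))

theorem act_mul (A B : SL2C) (x : Minkowski) : act (A * B) x = act A (act B x) := by
  rw [act, act, toHermitian_act, Matrix.SpecialLinearGroup.coe_mul, Matrix.conjTranspose_mul]
  simp only [Matrix.mul_assoc]

theorem ofHermitian_toHermitian (x : Minkowski) : ofHermitian (toHermitian x) = x := by
  ext i
  fin_cases i <;> simp [toHermitian, ofHermitian] <;> ring

theorem act_one (x : Minkowski) : act 1 x = x := by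
  simp [act, ofHermitian_toHermitian]

theorem act_act_inv (A : SL2C) (x : Minkowski) : act A (act A⁻¹ x) = x := by
  rw [← act_mul, mul_inv_cancel, act_one]

theorem mink_self_eq_det (x : Minkowski) : (mink x x : ℂ) = 4 * (toHermitian x).det := by
  rw [Matrix.det_fin_two]
  simp [toHermitian, mink]
  linear_combination (-(x 2 : ℂ) ^ 2) * Complex.I_sq

theorem mink_act_self (A : SL2C) (x : Minkowski) : mink (act A x) (act A x) = mink x x := by
  have h : (mink (act A x) (act A x) : ℂ) = mink x x := by
    rw [mink_self_eq_det, mink_self_eq_det, toHermitian_act, Matrix.det_mul, Matrix.det_mul,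
      Matrix.det_conjTranspose, A.2]
    simp
  exact_mod_cast h

theorem mink_act (A : SL2C) (x y : Minkowski) : mink (act A x) (act A y) = mink x y := by
  -- Polarization of the quadratic form.
  have h := mink_act_self A (x + y)
  have hx := mink_act_self A x
  have hy := mink_act_self A y
  rw [act_add] at h
  simp only [mink, Pi.add_apply] at h hx hy ⊢
  linarith

theorem continuous_act_left (x : Minkowski) : Continuous fun A : SL2C => act A x := by
  have hc : Continuous fun A : SL2C => (A : Matrix (Fin 2) (Fin 2) ℂ) * toHermitian x *
      (A : Matrix (Fin 2) (Fin 2) ℂ).conjTranspose :=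
    (continuous_subtype_val.matrix_mul continuous_const).matrix_mul
      continuous_subtype_val.matrix_conjTranspose
  have he : ∀ i j, Continuous fun A : SL2C => ((A : Matrix (Fin 2) (Fin 2) ℂ) * toHermitian x *
      (A : Matrix (Fin 2) (Fin 2) ℂ).conjTranspose) i j := fun i j => hc.matrix_elem i j
  refine continuous_pi fun k => ?_
  fin_cases k
  · exact Complex.continuous_re.comp ((he 0 0).add (he 1 1))
  · exact continuous_const.mul (Complex.continuous_re.comp (he 0 1))
  · exact continuous_const.mul (Complex.continuous_im.comp (he 0 1))
  · exact Complex.continuous_re.comp ((he 0 0).sub (he 1 1))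

/-! ### One-parameter subgroups -/

/-- The parabolic matrix with upper right entry `z`. -/
def upper (z : ℂ) : SL2C := ⟨!![1, z; 0, 1], by simp⟩

/-- The diagonal matrix with entries `exp c` and `exp (-c)`. -/
def diagExp (c : ℂ) : SL2C :=
  ⟨!![Complex.exp c, 0; 0, Complex.exp (-c)], by simp [← Complex.exp_add]⟩

/-- The rotation matrix which acts as the rotation by `t` about `∂Y`. -/
def rotY (t : ℝ) : SL2C :=
  ⟨!![(Real.cos (t / 2) : ℂ), -(Real.sin (t / 2) : ℂ); (Real.sin (t / 2) : ℂ),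
      (Real.cos (t / 2) : ℂ)], by
    rw [Matrix.det_fin_two_of]
    have := Real.cos_sq_add_sin_sq (t / 2)
    have h : ((Real.cos (t / 2) ^ 2 + Real.sin (t / 2) ^ 2 : ℝ) : ℂ) = 1 := by rw [this]; simp
    push_cast at h ⊢
    linear_combination h⟩

theorem upper_zero : upper 0 = 1 := by
  ext i j
  fin_cases i <;> fin_cases j <;> simp [upper]

theorem upper_add (z w : ℂ) : upper (z + w) = upper z * upper w := by
  ext i j
  rw [Matrix.SpecialLinearGroup.coe_mul]
  fin_cases i <;> fin_cases j <;> simp [upper, add_comm]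

theorem diagExp_zero : diagExp 0 = 1 := by
  ext i j
  fin_cases i <;> fin_cases j <;> simp [diagExp]

theorem diagExp_add (c d : ℂ) : diagExp (c + d) = diagExp c * diagExp d := by
  ext i j
  rw [Matrix.SpecialLinearGroup.coe_mul]
  fin_cases i <;> fin_cases j <;> simp [diagExp, Complex.exp_add, mul_comm]

theorem rotY_zero : rotY 0 = 1 := by
  ext i j
  fin_cases i <;> fin_cases j <;> simp [rotY]

theorem continuous_upper : Continuous upper := by
  refine Continuous.subtype_mk (continuous_matrix fun i j => ?_) _
  fin_cases i <;> fin_cases j <;> simp <;> fun_prop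

theorem continuous_diagExp : Continuous diagExp := by
  refine Continuous.subtype_mk (continuous_matrix fun i j => ?_) _
  fin_cases i <;> fin_cases j <;> simp <;> fun_prop

theorem continuous_rotY : Continuous rotY := by
  refine Continuous.subtype_mk (continuous_matrix fun i j => ?_) _
  fin_cases i <;> fin_cases j <;> simp <;> fun_prop

theorem act_upper (z : ℂ) (v : Minkowski) :
    act (upper z) v = v 0 • ![(2 + z.re ^ 2 + z.im ^ 2) / 2, z.re, z.im,
        (z.re ^ 2 + z.im ^ 2) / 2] +
      v 1 • ![z.re, 1, 0, z.re] + v 2 • ![z.im, 0, 1, z.im] +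
      v 3 • ![-(z.re ^ 2 + z.im ^ 2) / 2, -z.re, -z.im, (2 - z.re ^ 2 - z.im ^ 2) / 2] := by
  rw [act_eq (upper z) (a := 1) (b := 0) (c := z.re) (d := z.im) (e := 0) (f := 0) (g := 1)
    (h := 0) rfl v]
  ext i
  fin_cases i <;> simp <;> ring

/-- This null vector is point plus first vector of `baseFrame`, hence the normal of the horosphere
to which `baseFrame` is outward. The group `upper` preserves that horosphere. -/
theorem act_upper_null (z : ℂ) : act (upper z) ![1, 0, 0, 1] = ![1, 0, 0, 1] := by
  rw [act_upper]
  ext i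
  fin_cases i <;> simp <;> ring

theorem act_diagExp_ofReal (t : ℝ) (v : Minkowski) :
    act (diagExp ((t : ℂ) / 2)) v =
      ![Real.cosh t * v 0 + Real.sinh t * v 3, v 1, v 2,
        Real.sinh t * v 0 + Real.cosh t * v 3] := by
  have h1 : Real.exp (t / 2) * Real.exp (-(t / 2)) = 1 := by rw [← Real.exp_add]; simp
  have h2 : Real.exp t = Real.exp (t / 2) ^ 2 := by rw [sq, ← Real.exp_add]; congr 1; ring
  have h3 : Real.exp (-t) = Real.exp (-(t / 2)) ^ 2 := by
    rw [sq, ← Real.exp_add]; congr 1; ring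
  have e1 : Complex.exp ((t : ℂ) / 2) = ⟨Real.exp (t / 2), 0⟩ := by
    rw [← Complex.ofReal_ofNat, ← Complex.ofReal_div, ← Complex.ofReal_exp]; rfl
  have e2 : Complex.exp (-((t : ℂ) / 2)) = ⟨Real.exp (-(t / 2)), 0⟩ := by
    rw [← Complex.ofReal_ofNat, ← Complex.ofReal_div, ← Complex.ofReal_neg,
      ← Complex.ofReal_exp]; rfl
  rw [act_eq (diagExp ((t : ℂ) / 2)) (a := Real.exp (t / 2)) (b := 0) (c := 0) (d := 0) (e := 0)
    (f := 0) (g := Real.exp (-(t / 2))) (h := 0) (by simp only [diagExp, e1, e2]; rfl) v]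
  rw [Real.cosh_eq, Real.sinh_eq, h2, h3]
  ext i
  fin_cases i <;> simp [h1] <;> ring

theorem act_diagExp_mul_I (t : ℝ) (v : Minkowski) :
    act (diagExp ((t : ℂ) * Complex.I / 2)) v =
      ![v 0, Real.cos t * v 1 - Real.sin t * v 2, Real.sin t * v 1 + Real.cos t * v 2, v 3] := by
  have h1 := Real.cos_sq_add_sin_sq (t / 2)
  have h2 : Real.cos t = Real.cos (t / 2) ^ 2 - Real.sin (t / 2) ^ 2 := by
    rw [← Real.cos_two_mul', mul_div_cancel₀ _ two_ne_zero]
  have h3 : Real.sin t = 2 * Real.sin (t / 2) * Real.cos (t / 2) := by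
    rw [← Real.sin_two_mul, mul_div_cancel₀ _ two_ne_zero]
  have e1 : Complex.exp ((t : ℂ) * Complex.I / 2) = ⟨Real.cos (t / 2), Real.sin (t / 2)⟩ := by
    rw [mul_div_right_comm, ← Complex.ofReal_ofNat, ← Complex.ofReal_div, Complex.exp_mul_I,
      ← Complex.ofReal_cos, ← Complex.ofReal_sin]
    apply Complex.ext <;> simp [-Complex.ofReal_cos, -Complex.ofReal_sin]
  have e2 : Complex.exp (-((t : ℂ) * Complex.I / 2)) =
      ⟨Real.cos (t / 2), -Real.sin (t / 2)⟩ := by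
    rw [mul_div_right_comm, ← neg_mul, ← Complex.ofReal_ofNat, ← Complex.ofReal_div,
      ← Complex.ofReal_neg, Complex.exp_mul_I, ← Complex.ofReal_cos, ← Complex.ofReal_sin]
    apply Complex.ext <;> simp [-Complex.ofReal_cos, -Complex.ofReal_sin]
  rw [act_eq (diagExp ((t : ℂ) * Complex.I / 2)) (a := Real.cos (t / 2)) (b := Real.sin (t / 2))
    (c := 0) (d := 0) (e := 0) (f := 0) (g := Real.cos (t / 2)) (h := -Real.sin (t / 2))
    (by simp only [diagExp, e1, e2]; rfl) v]
  rw [h2, h3]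
  ext i
  fin_cases i <;> simp
  · linear_combination (v 0 - v 3) / 2 * h1
  · ring
  · ring
  · linear_combination (v 3 - v 0) / 2 * h1

theorem act_rotY (t : ℝ) (v : Minkowski) :
    act (rotY t) v =
      ![v 0, Real.cos t * v 1 + Real.sin t * v 3, v 2, Real.cos t * v 3 - Real.sin t * v 1] := by
  have h1 := Real.cos_sq_add_sin_sq (t / 2)
  have h2 : Real.cos t = Real.cos (t / 2) ^ 2 - Real.sin (t / 2) ^ 2 := by
    rw [← Real.cos_two_mul', mul_div_cancel₀ _ two_ne_zero]
  have h3 : Real.sin t = 2 * Real.sin (t / 2) * Real.cos (t / 2) := by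
    rw [← Real.sin_two_mul, mul_div_cancel₀ _ two_ne_zero]
  rw [act_eq (rotY t) (a := Real.cos (t / 2)) (b := 0) (c := -Real.sin (t / 2)) (d := 0)
    (e := Real.sin (t / 2)) (f := 0) (g := Real.cos (t / 2)) (h := 0)
    (by
      ext i j
      fin_cases i <;> fin_cases j <;> apply Complex.ext <;>
        simp [rotY, -Complex.ofReal_cos, -Complex.ofReal_sin]) v]
  rw [h2, h3]
  ext i
  fin_cases i <;> simp
  · linear_combination v 0 / 2 * h1
  · ring
  · linear_combination v 2 * h1
  · linear_combination -(v 0 / 2) * h1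

/-! ### Frames under right multiplication -/

/-- The matrix on the right acts first, on `baseFrame`, where the claim is explicit; linearity of
`act A` carries it to the frame of `A`. -/
theorem frameOf_mul_diagExp_ofReal (A : SpinFrame) (t : ℝ) :
    frameOf (A * diagExp ((t : ℂ) / 2)) = (frameOf A).translate t := by
  ext1 <;> simp only [frameOf, Triad.translate, baseFrame, act_mul, act_diagExp_ofReal,
    ← act_smul, ← act_add] <;> congr 1 <;> ext i <;> fin_cases i <;> simp

theorem frameOf_mul_diagExp_mul_I (A : SpinFrame) (t : ℝ) :
    frameOf (A * diagExp ((t : ℂ) * Complex.I / 2)) =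
      ⟨(frameOf A).pt, (frameOf A).f₁, Real.cos t • (frameOf A).f₂ + Real.sin t • (frameOf A).f₃,
        Real.cos t • (frameOf A).f₃ - Real.sin t • (frameOf A).f₂⟩ := by
  ext1 <;> simp only [frameOf, baseFrame, act_mul, act_diagExp_mul_I,
    ← act_smul, ← act_add, ← act_sub] <;> congr 1 <;> ext i <;> fin_cases i <;> simp

theorem frameOf_mul_rotY (A : SpinFrame) (t : ℝ) :
    frameOf (A * rotY t) =
      ⟨(frameOf A).pt, Real.cos t • (frameOf A).f₁ - Real.sin t • (frameOf A).f₃, (frameOf A).f₂,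
        Real.cos t • (frameOf A).f₃ + Real.sin t • (frameOf A).f₁⟩ := by
  ext1 <;> simp only [frameOf, baseFrame, act_mul, act_rotY,
    ← act_smul, ← act_add, ← act_sub] <;> congr 1 <;> ext i <;> fin_cases i <;> simp

/-! ### The cross product -/

theorem cross_self (q v : Minkowski) : cross q v v = 0 := by
  funext i
  rw [cross, Matrix.det_zero_of_row_eq (i := 1) (j := 2) (by decide) rfl]
  simp

theorem cross_comm (q v w : Minkowski) : cross q v w = -cross q w v := by
  funext i
  simp only [cross, Pi.neg_apply, Matrix.det_succ_row_zero, Fin.sum_univ_succ]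
  simp [Fin.succAbove]
  ring

theorem cross_neg_right (q v w : Minkowski) : cross q v (-w) = -cross q v w := by
  funext i
  simp only [cross, Pi.neg_apply, Matrix.det_succ_row_zero, Fin.sum_univ_succ]
  simp [Fin.succAbove]
  ring

theorem cross_frameOf₁₂ (A : SpinFrame) :
    cross (frameOf A).pt (frameOf A).f₁ (frameOf A).f₂ = (frameOf A).f₃ :=
  (frameOf_isFrame A).cross_eq

/-- A quarter turn about the first vector gives another frame, with second and third vectors `f₃`
and `-f₂`. A quarter turn about `f₂` serves likewise for `cross_frameOf₂₃`. -/
theorem cross_frameOf₁₃ (A : SpinFrame) :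
    cross (frameOf A).pt (frameOf A).f₁ (frameOf A).f₃ = -(frameOf A).f₂ := by
  have h := cross_frameOf₁₂ (A * diagExp ((Real.pi / 2 : ℝ) * Complex.I / 2))
  rw [frameOf_mul_diagExp_mul_I] at h
  simpa using h

theorem cross_frameOf₂₃ (A : SpinFrame) :
    cross (frameOf A).pt (frameOf A).f₂ (frameOf A).f₃ = (frameOf A).f₁ := by
  have h := cross_frameOf₁₂ (A * rotY (Real.pi / 2))
  rw [frameOf_mul_rotY] at h
  simp only [Real.cos_pi_div_two, Real.sin_pi_div_two, zero_smul, one_smul, zero_sub,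
    zero_add] at h
  rwa [cross_comm, cross_neg_right, neg_neg] at h

theorem frameOf_rotate₁ (A : SpinFrame) (t : ℝ) :
    frameOf (A * diagExp ((t : ℂ) * Complex.I / 2)) = (frameOf A).rotate (frameOf A).f₁ t := by
  have hA := frameOf_isFrame A
  rw [frameOf_mul_diagExp_mul_I]
  ext1 <;> simp only [Triad.rotate, Triad.rotateVec, cross_self, cross_frameOf₁₂,
    cross_frameOf₁₃, hA.unit₁, hA.orth₁₂, hA.orth₁₃]
  · module
  · module
  · module

theorem frameOf_rotate₂ (A : SpinFrame) (t : ℝ) :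
    frameOf (A * rotY t) = (frameOf A).rotate (frameOf A).f₂ t := by
  have hA := frameOf_isFrame A
  have h12 : mink (frameOf A).f₂ (frameOf A).f₁ = 0 := by
    rw [← hA.orth₁₂]; simp only [mink]; ring
  rw [frameOf_mul_rotY]
  ext1 <;> simp only [Triad.rotate, Triad.rotateVec, cross_self, cross_frameOf₂₃,
    cross_comm _ (frameOf A).f₂ (frameOf A).f₁, cross_frameOf₁₂, hA.unit₂, h12, hA.orth₂₃]
  · module
  · module
  · module

/-! ### Unique lifting -/

theorem specialLinear_ne_neg (A : SL2C) : A ≠ -A := by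
  intro h
  have hd := A.2
  have h0 : ∀ i j, (A : Matrix (Fin 2) (Fin 2) ℂ) i j = 0 := fun i j => by
    have := congrArg (fun B : SL2C => (B : Matrix (Fin 2) (Fin 2) ℂ) i j) h
    simp only [Matrix.SpecialLinearGroup.coe_neg, Matrix.neg_apply] at this
    exact self_eq_neg.1 this
  rw [Matrix.det_fin_two] at hd
  simp [h0] at hd

/-- The fibres are pairs `{A, -A}`, so the locus `f = g` is closed and its complement is the closed
locus `f = -g`. Connectedness decides. Every path lift in the definitions is made explicit through
this. -/
theorem eq_of_frameOf_eq {X : Type*} [TopologicalSpace X] [PreconnectedSpace X]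
    {f g : X → SpinFrame} (hf : Continuous f) (hg : Continuous g)
    (h : ∀ x, frameOf (f x) = frameOf (g x)) (x₀ : X) (h₀ : f x₀ = g x₀) : f = g := by
  have hcl : IsClosed {x | f x = g x} := isClosed_eq hf hg
  have hop : IsOpen {x | f x = g x} := by
    have : {x | f x = g x} = {x | f x = -g x}ᶜ := by
      ext x
      simp only [Set.mem_ofPred_eq, Set.mem_compl_iff]
      constructor
      · intro hx hx'
        exact specialLinear_ne_neg _ (hx.symm.trans hx')
      · intro hx
        exact ((frameOf_eq_iff _ _).1 (h x)).resolve_right hx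
    rw [this]
    have hneg : Continuous fun x => -g x :=
      Continuous.subtype_mk (continuous_subtype_val.comp hg).neg _
    exact (isClosed_eq hf hneg).isOpen_compl
  have hu := IsClopen.eq_univ ⟨hcl, hop⟩ ⟨x₀, h₀⟩
  funext x
  exact (hu ▸ Set.mem_univ x : x ∈ {x | f x = g x})

theorem isTranslation_iff (A B : SpinFrame) (s : ℝ) :
    IsTranslation A s B ↔ B = A * diagExp ((s : ℂ) / 2) := by
  have hc : Continuous fun t : ℝ => A * diagExp ((t : ℂ) / 2) :=
    continuous_const.mul (continuous_diagExp.comp (by fun_prop))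
  constructor
  · rintro ⟨γ, hγ, h0, h, rfl⟩
    exact congrFun (eq_of_frameOf_eq hγ hc
      (fun t => by rw [h, frameOf_mul_diagExp_ofReal]) 0 (by simp [h0, diagExp_zero])) s
  · rintro rfl
    exact ⟨_, hc, by simp [diagExp_zero], frameOf_mul_diagExp_ofReal A, rfl⟩

theorem isRotation₁_iff (A B : SpinFrame) (θ : ℝ) :
    IsRotation A (frameOf A).f₁ θ B ↔ B = A * diagExp ((θ : ℂ) * Complex.I / 2) := by
  have hc : Continuous fun t : ℝ => A * diagExp ((t : ℂ) * Complex.I / 2) :=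
    continuous_const.mul (continuous_diagExp.comp (by fun_prop))
  constructor
  · rintro ⟨γ, hγ, h0, h, rfl⟩
    exact congrFun (eq_of_frameOf_eq hγ hc
      (fun t => by rw [h, frameOf_rotate₁]) 0 (by simp [h0, diagExp_zero])) θ
  · rintro rfl
    exact ⟨_, hc, by simp [diagExp_zero], frameOf_rotate₁ A, rfl⟩

theorem eq_mul_rotY_of_isRotation {A B : SpinFrame} {θ : ℝ}
    (h : IsRotation A (frameOf A).f₂ θ B) : B = A * rotY θ := by
  obtain ⟨γ, hγ, h0, h, rfl⟩ := h
  have hc : Continuous fun t : ℝ => A * rotY t := continuous_const.mul continuous_rotY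
  exact congrFun (eq_of_frameOf_eq hγ hc
    (fun t => by rw [h, frameOf_rotate₂]) 0 (by simp [h0, rotY_zero])) θ

/-- Translation and rotation along the same axis combine into one complex one-parameter subgroup.
The factor `1 / 2` is that of the double cover and matches the one in `exp (d / 2)`. -/
theorem isComplexDistance_iff (γ : OrientedGeodesic) (A B : SpinFrame) (d : ℂ) :
    IsComplexDistance γ A B d ↔
      γ.Adapted (frameOf A) ∧ γ.Adapted (frameOf B) ∧ B = A * diagExp (d / 2) := by
  have hd : d / 2 = (d.re : ℂ) / 2 + (d.im : ℂ) * Complex.I / 2 := by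
    rw [← add_div, Complex.re_add_im]
  simp only [IsComplexDistance, isTranslation_iff, isRotation₁_iff, exists_eq_left, hd,
    diagExp_add, mul_assoc]

/-! ### Points of a horosphere and parallel fields -/

theorem mink_null_right (x : Minkowski) : mink x ![1, 0, 0, 1] = x 0 - x 3 := by
  simp [mink]

/-- On the standard horosphere `x 0 - x 3 = 1`, and the norm condition then gives `x 0 + x 3 = 1 + x
1 ^ 2 + x 2 ^ 2`. Thus `x 1` and `x 2` are coordinates, realised by a parabolic translation of the
base point. -/
theorem act_upper_base {x : Minkowski} (hx : mink x x = 1) (hl : mink x ![1, 0, 0, 1] = 1) :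
    act (upper ⟨x 1, x 2⟩) ![1, 0, 0, 0] = x := by
  rw [mink_null_right] at hl
  simp only [mink] at hx
  have h0 : x 0 = 1 + x 3 := by linarith
  rw [h0] at hx
  rw [act_upper]
  ext i
  fin_cases i <;> simp <;> nlinarith

namespace Horosphere

variable {H : Horosphere}

theorem act_base_mem_points {A : SL2C} (hA : act A ![1, 0, 0, 1] = H.normal) :
    act A ![1, 0, 0, 0] ∈ H.points :=
  ⟨(frameOf_isFrame A).pt_mem, by rw [← hA, mink_act]; simp [mink]⟩

theorem act_mul_upper_null {A : SL2C} (hA : act A ![1, 0, 0, 1] = H.normal) (z : ℂ) :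
    act (A * upper z) ![1, 0, 0, 1] = H.normal := by
  rw [act_mul, act_upper_null, hA]

theorem exists_act_mul_upper {A : SL2C} (hA : act A ![1, 0, 0, 1] = H.normal) {q : Minkowski}
    (hq : q ∈ H.points) : ∃ z, q = act (A * upper z) ![1, 0, 0, 0] := by
  refine ⟨⟨act A⁻¹ q 1, act A⁻¹ q 2⟩, ?_⟩
  rw [act_mul, act_upper_base, act_act_inv]
  · rw [mink_act_self, hq.1.1]
  · rw [← mink_act A, act_act_inv, hA, hq.2]

theorem image_act_points {A : SL2C} (hA : act A ![1, 0, 0, 1] = H.normal) (z : ℂ) :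
    act (A * upper z * A⁻¹) '' H.points = H.points := by
  ext q
  constructor
  · rintro ⟨p, hp, rfl⟩
    obtain ⟨w, rfl⟩ := exists_act_mul_upper hA hp
    rw [← act_mul, ← mul_assoc, inv_mul_cancel_right, mul_assoc, ← upper_add]
    exact act_base_mem_points (act_mul_upper_null hA _)
  · intro hq
    obtain ⟨w, rfl⟩ := exists_act_mul_upper hA hq
    refine ⟨_, act_base_mem_points (act_mul_upper_null hA (w - z)), ?_⟩
    rw [← act_mul, ← mul_assoc, inv_mul_cancel_right, mul_assoc, ← upper_add, add_sub_cancel]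

theorem isParabolic_conj_upper (A : SL2C) {z : ℂ} (hz : z ≠ 0) :
    ((A * upper z * A⁻¹ : SL2C) : Matrix (Fin 2) (Fin 2) ℂ).IsParabolic := by
  have h : (upper z : Matrix (Fin 2) (Fin 2) ℂ).IsParabolic := by
    rw [Matrix.isParabolic_iff_of_upperTriangular (by simp [upper])]
    simpa [upper] using hz
  have h' := (Matrix.isParabolic_conj_iff (A : GL (Fin 2) ℂ)).2 h
  rw [← Matrix.coe_units_inv] at h'
  rw [Matrix.SpecialLinearGroup.coe_mul, Matrix.SpecialLinearGroup.coe_mul]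
  exact h'

/-- A parallel field is constant in the frames `A * upper z`. -/
theorem IsParallelUnitField.eq_act {v : H.points → Minkowski} (hv : H.IsParallelUnitField v)
    {A : SL2C} (hA : act A ![1, 0, 0, 1] = H.normal) {u : Minkowski} {q₀ : H.points}
    (hq₀ : (q₀ : Minkowski) = act A ![1, 0, 0, 0]) (hu : v q₀ = act A u) (z : ℂ) {q : H.points}
    (hq : (q : Minkowski) = act (A * upper z) ![1, 0, 0, 0]) :
    v q = act (A * upper z) u := by
  -- The identity is not parabolic, so `z = 0` is not covered by the invariance hypothesis.
  rcases eq_or_ne z 0 with rfl | hz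
  · rw [upper_zero, mul_one] at hq ⊢
    rw [← hu]
    congr 1
    exact Subtype.ext (hq.trans hq₀.symm)
  · rw [hv.parallel _ (isParabolic_conj_upper A hz) (image_act_points hA z) q₀ q
      (by rw [hq, hq₀, ← act_mul, inv_mul_cancel_right]), hu, ← act_mul, inv_mul_cancel_right]

theorem points_nonempty (H : Horosphere) : H.points.Nonempty := by
  obtain ⟨p, hp, h0⟩ := H
  -- For `a • p + b • ![1, 0, 0, 0]` the conditions read `b * p 0 = 1` and `2 * a * b * p 0 + b ^ 2
  -- = 1`.
  refine ⟨((1 - (p 0)⁻¹ ^ 2) / 2) • p + (p 0)⁻¹ • ![1, 0, 0, 0], ⟨?_, ?_⟩, ?_⟩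
  · simp only [mink, Pi.add_apply, Pi.smul_apply, smul_eq_mul] at hp ⊢
    simp
    field_simp
    linear_combination (p 0 ^ 2 - 1) ^ 2 * hp
  · have : 0 < p 0 / 2 + (p 0)⁻¹ / 2 := by positivity
    convert this using 1
    simp
    field_simp
    ring
  · simp only [mink, Pi.add_apply, Pi.smul_apply, smul_eq_mul] at hp ⊢
    simp
    field_simp
    linear_combination (p 0 ^ 2 - 1) * hp

end Horosphere

/-! ### The spinor of a spin decoration -/

theorem act_null_eq_pt_add (A : SL2C) :
    act A ![1, 0, 0, 1] = (frameOf A).pt + (frameOf A).f₁ := by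
  simp only [frameOf, baseFrame, ← act_add]
  congr 1
  ext i
  fin_cases i <;> simp

theorem Triad.IsFrame.ext {F G : Triad} (hF : F.IsFrame) (hG : G.IsFrame) (hp : F.pt = G.pt)
    (h₁ : F.f₁ = G.f₁) (h₂ : F.f₂ = G.f₂) : F = G :=
  Triad.ext hp h₁ h₂ (by rw [← hF.cross_eq, ← hG.cross_eq, hp, h₁, h₂])

namespace SpinDecoration

variable {H : Horosphere} (W : SpinDecoration H)

theorem act_outward_null (q : H.points) : act (W.outward q) ![1, 0, 0, 1] = H.normal := by
  rw [act_null_eq_pt_add, W.lift_outward]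
  simp [Horosphere.outwardFrame, Horosphere.outwardNormal]

theorem act_outward_base (q : H.points) : act (W.outward q) ![1, 0, 0, 0] = q :=
  congrArg Triad.pt (W.lift_outward q)

theorem act_outward_v (q : H.points) : act (W.outward q) ![0, 0, 1, 0] = W.v q :=
  congrArg Triad.f₂ (W.lift_outward q)

theorem inward_eq (q : H.points) : W.inward q = W.outward q * rotY Real.pi := by
  have h := W.associated q
  rw [← W.act_outward_v q] at h
  exact eq_mul_rotY_of_isRotation h

/-- The outward spin frames of a spin decoration are the right translates of one of them by the
group of upper unitriangular matrices. -/
theorem exists_outward_eq : ∃ A : SL2C, act A ![1, 0, 0, 1] = H.normal ∧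
    (∀ q, ∃ z, W.outward q = A * upper z) ∧ ∀ z, ∃ q, W.outward q = A * upper z := by
  obtain ⟨q₀, hq₀⟩ := H.points_nonempty
  lift q₀ to H.points using hq₀
  set A := W.outward q₀ with hA
  have hn : act A ![1, 0, 0, 1] = H.normal := W.act_outward_null q₀
  have hb : act A ![1, 0, 0, 0] = q₀ := W.act_outward_base q₀
  let q : ℂ → H.points := fun z =>
    ⟨act (A * upper z) ![1, 0, 0, 0],
      Horosphere.act_base_mem_points (Horosphere.act_mul_upper_null hn z)⟩
  have hcu : Continuous fun z : ℂ => A * upper z := continuous_const.mul continuous_upper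
  have hq : Continuous q := ((continuous_act_left _).comp hcu).subtype_mk _
  have hq0 : q 0 = q₀ := Subtype.ext (by simp [q, upper_zero, hb])
  -- Both are continuous lifts over the connected plane `ℂ` that agree at `0`. Their frames
  -- coincide: the normal vector fixes `f₁`, parallelism fixes `f₂`, and the cross product fixes
  -- `f₃`.
  have key : W.outward ∘ q = fun z => A * upper z := by
    refine eq_of_frameOf_eq (W.continuous_outward.comp hq) hcu (fun z => ?_) 0
      (by simp [hq0, upper_zero, hA])
    have hp : (frameOf (W.outward (q z))).pt = (frameOf (A * upper z)).pt :=
      W.act_outward_base (q z)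
    refine (frameOf_isFrame _).ext (frameOf_isFrame _) hp ?_ ?_
    · have h := (W.act_outward_null (q z)).trans (Horosphere.act_mul_upper_null hn z).symm
      rw [act_null_eq_pt_add, act_null_eq_pt_add, hp] at h
      exact add_left_cancel h
    · exact (W.act_outward_v (q z)).trans
        (W.isParallel.eq_act hn hb.symm (W.act_outward_v q₀).symm z rfl)
  refine ⟨A, hn, fun p => ?_, fun z => ⟨q z, congrFun key z⟩⟩
  obtain ⟨z, hz⟩ := Horosphere.exists_act_mul_upper hn p.2
  refine ⟨z, ?_⟩
  rw [show p = q z from Subtype.ext hz]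
  exact congrFun key z

end SpinDecoration

/-! ### Complex lambda lengths -/

theorem rotY_pi : (rotY Real.pi : Matrix (Fin 2) (Fin 2) ℂ) = !![0, -1; 1, 0] := by
  simp [rotY, -Complex.ofReal_cos, -Complex.ofReal_sin]

/-- The decomposition of a unimodular matrix in the big Bruhat cell. -/
theorem exists_upper_mul_rotY_mul_diagExp {g : SL2C} (hg : g 1 0 ≠ 0) {c : ℂ}
    (hc : Complex.exp c = g 1 0) :
    ∃ z w, g * upper w = upper z * rotY Real.pi * diagExp c := by
  -- The right side is `!![z * exp c, -exp (-c); exp c, 0]`: the zero entry determines `w`, the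
  -- first column determines `z`.
  refine ⟨g 0 0 / g 1 0, -(g 1 1 / g 1 0), ?_⟩
  have hd := g.2
  rw [Matrix.det_fin_two] at hd
  ext i j
  simp only [Matrix.SpecialLinearGroup.coe_mul, rotY_pi]
  fin_cases i <;> fin_cases j <;>
    simp [upper, diagExp, Matrix.mul_apply, Fin.sum_univ_two, Complex.exp_neg, hc]
  · field_simp
  · field_simp
    linear_combination -hd
  · field_simp
    ring

theorem apply_one_zero_of_bruhat {g : SL2C} {z w c : ℂ}
    (h : g * upper w = upper z * rotY Real.pi * diagExp c) : g 1 0 = Complex.exp c := by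
  have := congrArg (fun B : SL2C => (B : Matrix (Fin 2) (Fin 2) ℂ) 1 0) h
  simp only [Matrix.SpecialLinearGroup.coe_mul, rotY_pi] at this
  simpa [upper, diagExp, Matrix.mul_apply, Fin.sum_univ_two] using this

/-- The null vector has Hermitian matrix `diag(1, 0)`, so its image is `κ κ*` for the first column
`κ` of `g`. Pairing with the null vector doubles the lower right entry. -/
theorem mink_act_null (g : SL2C) :
    mink (act g ![1, 0, 0, 1]) ![1, 0, 0, 1] = 2 * Complex.normSq (g 1 0) := by
  obtain ⟨a, b, c, d, e, f, g', h, hA, -, -⟩ := exists_real_entries g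
  rw [act_eq g hA, hA, mink_null_right]
  simp [Complex.normSq_mk]
  ring

theorem mink_act_null_act_null (A B : SL2C) :
    mink (act A ![1, 0, 0, 1]) (act B ![1, 0, 0, 1]) =
      2 * Complex.normSq ((A⁻¹ * B) 1 0) := by
  rw [← mink_act_null, act_mul, ← mink_act A (act A⁻¹ _), act_act_inv]
  simp only [mink]
  ring

/-- Two points of the light cone are orthogonal if and only if they are on the same ray. -/
theorem mink_eq_zero_iff_of_mem_lightCone {x y : Minkowski} (hx : x ∈ lightCone)
    (hy : y ∈ lightCone) : mink x y = 0 ↔ (x 0)⁻¹ • x = (y 0)⁻¹ • y := by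
  obtain ⟨hx, hx0⟩ := hx
  obtain ⟨hy, hy0⟩ := hy
  constructor
  · intro h
    simp only [mink] at hx hy h
    -- For null vectors this sum of squares equals `2 * x 0 * y 0 * mink x y`.
    have hs : (y 0 * x 1 - x 0 * y 1) ^ 2 + (y 0 * x 2 - x 0 * y 2) ^ 2 +
        (y 0 * x 3 - x 0 * y 3) ^ 2 = 0 := by
      linear_combination (-(y 0 ^ 2)) * hx - x 0 ^ 2 * hy + 2 * x 0 * y 0 * h
    have h1 : y 0 * x 1 - x 0 * y 1 = 0 := by nlinarith
    have h2 : y 0 * x 2 - x 0 * y 2 = 0 := by nlinarith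
    have h3 : y 0 * x 3 - x 0 * y 3 = 0 := by nlinarith
    ext i
    simp only [Pi.smul_apply, smul_eq_mul]
    fin_cases i <;> simp <;> field_simp <;> linarith
  · intro h
    have hxy : x = (x 0 * (y 0)⁻¹) • y := by
      rw [mul_smul, ← h, smul_smul, mul_inv_cancel₀ hx0.ne', one_smul]
    rw [hxy]
    simp only [mink, Pi.smul_apply, smul_eq_mul] at hy ⊢
    linear_combination (x 0 * (y 0)⁻¹) * hy

/-! ### The geodesic of a spin frame -/

theorem tendsto_normalize {ι : Type*} {l : Filter ι} {c s : ι → ℝ} (hc : ∀ t, c t ≠ 0)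
    (hs : Filter.Tendsto s l (𝓝 0)) {x y : Minkowski} (hx : x 0 ≠ 0) :
    Filter.Tendsto (fun t => ((c t • (x + s t • y)) 0)⁻¹ • (c t • (x + s t • y))) l
      (𝓝 ((x 0)⁻¹ • x)) := by
  have h1 : Filter.Tendsto (fun t => x + s t • y) l (𝓝 x) := by
    simpa using tendsto_const_nhds.add (hs.smul_const y)
  have h2 : Filter.Tendsto (fun t => ((x + s t • y) 0)⁻¹) l (𝓝 (x 0)⁻¹) :=
    (((continuous_apply 0).tendsto x).comp h1).inv₀ hx
  refine (h2.smul h1).congr fun t => ?_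
  rw [Pi.smul_apply, smul_eq_mul, smul_smul, mul_inv_rev, mul_assoc, inv_mul_cancel₀ (hc t),
    mul_one]

/-- The point at time `t` is `exp t / 2` times `base + dir` plus `exp (-t) / 2` times `base - dir`;
after normalization only the dominant null vector survives at each end. -/
theorem OrientedGeodesic.runsFromTo (γ : OrientedGeodesic) (h₀ : (γ.base - γ.dir) 0 ≠ 0)
    (h₁ : (γ.base + γ.dir) 0 ≠ 0) :
    γ.RunsFromTo (((γ.base - γ.dir) 0)⁻¹ • (γ.base - γ.dir))
      (((γ.base + γ.dir) 0)⁻¹ • (γ.base + γ.dir)) := by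
  have hm : ∀ t : ℝ, Real.exp (-t) = Real.exp t * Real.exp (-2 * t) := fun t => by
    rw [← Real.exp_add]; ring_nf
  have hp : ∀ t : ℝ, Real.exp t = Real.exp (-t) * Real.exp (2 * t) := fun t => by
    rw [← Real.exp_add]; ring_nf
  constructor
  · have ht : Filter.Tendsto (fun t : ℝ => Real.exp (2 * t)) Filter.atBot (𝓝 0) :=
      Real.tendsto_exp_atBot.comp (Filter.tendsto_id.const_mul_atBot two_pos)
    refine (tendsto_normalize (c := fun t => Real.exp (-t) / 2) (fun t => by positivity) ht
      (y := γ.base + γ.dir) h₀).congr fun t => ?_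
    have : γ.point t = (Real.exp (-t) / 2) •
        (γ.base - γ.dir + Real.exp (2 * t) • (γ.base + γ.dir)) := by
      rw [OrientedGeodesic.point, Real.cosh_eq, Real.sinh_eq, hp t]
      module
    rw [this]
  · have ht : Filter.Tendsto (fun t : ℝ => Real.exp (-2 * t)) Filter.atTop (𝓝 0) :=
      Real.tendsto_exp_atBot.comp
        (Filter.tendsto_id.const_mul_atTop_of_neg (neg_lt_zero.2 two_pos))
    refine (tendsto_normalize (c := fun t => Real.exp t / 2) (fun t => by positivity) ht
      (y := γ.base - γ.dir) h₁).congr fun t => ?_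
    have : γ.point t = (Real.exp t / 2) •
        (γ.base + γ.dir + Real.exp (-2 * t) • (γ.base - γ.dir)) := by
      rw [OrientedGeodesic.point, Real.cosh_eq, Real.sinh_eq, hm t]
      module
    rw [this]

/-- The geodesic through the point of a spin frame in the direction of its first vector. -/
def geodesicOf (A : SpinFrame) : OrientedGeodesic where
  base := (frameOf A).pt
  dir := (frameOf A).f₁
  base_mem := (frameOf_isFrame A).pt_mem
  tangent := (frameOf_isFrame A).tangent₁
  unit := (frameOf_isFrame A).unit₁

theorem adapted_geodesicOf_mul_diagExp (A : SpinFrame) (c : ℂ) :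
    (frameOf (A * diagExp c)).pt = (geodesicOf A).point (2 * c.re) ∧
      (frameOf (A * diagExp c)).f₁ = (geodesicOf A).velocity (2 * c.re) := by
  have hc : c = ((2 * c.re : ℝ) : ℂ) / 2 + ((2 * c.im : ℝ) : ℂ) * Complex.I / 2 := by
    push_cast
    rw [mul_assoc, mul_div_cancel_left₀ _ two_ne_zero, mul_div_cancel_left₀ _ two_ne_zero,
      Complex.re_add_im]
  have h : frameOf (A * diagExp c) = frameOf (A * diagExp (((2 * c.re : ℝ) : ℂ) / 2) *
      diagExp (((2 * c.im : ℝ) : ℂ) * Complex.I / 2)) := by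
    rw [mul_assoc, ← diagExp_add, ← hc]
  rw [h, frameOf_mul_diagExp_mul_I, frameOf_mul_diagExp_ofReal]
  exact ⟨rfl, rfl⟩

/-- The half turn about `f₂` reverses `f₁`. Hence the geodesic of an inward frame starts at the
centre of its horosphere. -/
theorem pt_sub_f₁_mul_rotY_pi (A : SL2C) :
    (frameOf (A * rotY Real.pi)).pt - (frameOf (A * rotY Real.pi)).f₁ =
      act A ![1, 0, 0, 1] := by
  rw [frameOf_mul_rotY, act_null_eq_pt_add]
  simp

theorem act_diagExp_null (A : SL2C) (c : ℂ) :
    act (A * diagExp c) ![1, 0, 0, 1] = Real.exp (2 * c.re) • act A ![1, 0, 0, 1] := by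
  rw [act_null_eq_pt_add, act_null_eq_pt_add, (adapted_geodesicOf_mul_diagExp A c).1,
    (adapted_geodesicOf_mul_diagExp A c).2, OrientedGeodesic.point, OrientedGeodesic.velocity,
    ← Real.cosh_add_sinh]
  simp only [geodesicOf]
  module

/-! ### Complex lambda lengths as brackets of spinors -/

/-- The lower left entry of `A⁻¹ * B` vanishes exactly when the centres agree. Otherwise `A⁻¹ * B`
lies in the big Bruhat cell, whose decomposition gives both uniqueness and existence of the length.
-/
theorem isComplexLambdaLength_iff {S₁ S₂ : SpinDecoratedHorosphere} {A B : SL2C}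
    (hA : act A ![1, 0, 0, 1] = S₁.H.normal) (hB : act B ![1, 0, 0, 1] = S₂.H.normal)
    (hA₁ : ∀ q, ∃ z, S₁.W.outward q = A * upper z) (hA₂ : ∀ z, ∃ q, S₁.W.outward q = A * upper z)
    (hB₁ : ∀ q, ∃ z, S₂.W.outward q = B * upper z) (hB₂ : ∀ z, ∃ q, S₂.W.outward q = B * upper z)
    (z : ℂ) : IsComplexLambdaLength S₁ S₂ z ↔ z = (A⁻¹ * B) 1 0 := by
  have hcentre : S₁.H.centre = S₂.H.centre ↔ (A⁻¹ * B) 1 0 = 0 := by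
    rw [Horosphere.centre, Horosphere.centre,
      ← mink_eq_zero_iff_of_mem_lightCone S₁.H.normal_mem S₂.H.normal_mem, ← hA, ← hB,
      mink_act_null_act_null, mul_eq_zero, or_iff_right two_ne_zero, Complex.normSq_eq_zero]
  by_cases hc : S₁.H.centre = S₂.H.centre
  · simp [IsComplexLambdaLength, hc, hcentre.1 hc]
  simp only [IsComplexLambdaLength, hc, false_and, ne_eq, not_false_eq_true, true_and, false_or]
  constructor
  · rintro ⟨γ, p₁, p₂, d, -, -, -, hd, rfl⟩
    obtain ⟨-, -, h⟩ := (isComplexDistance_iff _ _ _ _).1 hd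
    obtain ⟨z, hz⟩ := hA₁ p₁
    obtain ⟨w, hw⟩ := hB₁ p₂
    refine (apply_one_zero_of_bruhat (z := z) (w := w) ?_).symm
    rw [mul_assoc, ← hw, h, S₁.W.inward_eq, hz]
    simp only [mul_assoc, inv_mul_cancel_left]
  · rintro rfl
    have hg : (A⁻¹ * B) 1 0 ≠ 0 := mt hcentre.2 hc
    -- Any logarithm would do, since only `exp c` enters the length.
    set c := Complex.log ((A⁻¹ * B) 1 0)
    have hexp : Complex.exp c = (A⁻¹ * B) 1 0 := Complex.exp_log hg
    obtain ⟨z, w, h⟩ := exists_upper_mul_rotY_mul_diagExp hg hexp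
    obtain ⟨p₁, hp₁⟩ := hA₂ z
    obtain ⟨p₂, hp₂⟩ := hB₂ w
    have hout : S₂.W.outward p₂ = S₁.W.inward p₁ * diagExp c := by
      rw [hp₂, S₁.W.inward_eq, hp₁, mul_assoc A, mul_assoc A, ← h, mul_assoc,
        mul_inv_cancel_left]
    -- The geodesic is the axis of this inward frame. The next facts identify its end vectors with
    -- the normals of the two horospheres, up to a positive factor for the second.
    set M := S₁.W.inward p₁ with hM
    have hp₁' : (p₁ : Minkowski) = (frameOf M).pt := by rw [hM, S₁.W.lift_inward]; rfl
    have hp₂' : (p₂ : Minkowski) = (frameOf (M * diagExp c)).pt := by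
      rw [← hout, S₂.W.lift_outward]; rfl
    have had := adapted_geodesicOf_mul_diagExp M c
    have hminus : (geodesicOf M).base - (geodesicOf M).dir = S₁.H.normal := by
      rw [← S₁.W.act_outward_null p₁, ← pt_sub_f₁_mul_rotY_pi, ← S₁.W.inward_eq]; rfl
    have hplus : S₂.H.normal =
        Real.exp (2 * c.re) • ((geodesicOf M).base + (geodesicOf M).dir) := by
      rw [← S₂.W.act_outward_null p₂, hout, act_diagExp_null, act_null_eq_pt_add]; rfl
    have h₀ : ((geodesicOf M).base - (geodesicOf M).dir) 0 ≠ 0 := by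
      rw [hminus]; exact S₁.H.normal_mem.2.ne'
    have h₁ : ((geodesicOf M).base + (geodesicOf M).dir) 0 ≠ 0 := by
      have := S₂.H.normal_mem.2.ne'
      rw [hplus, Pi.smul_apply, smul_eq_mul] at this
      exact right_ne_zero_of_mul this
    refine ⟨geodesicOf M, p₁, p₂, 2 * c, ?_, ⟨0, ?_⟩, ⟨2 * c.re, ?_⟩, ?_, ?_⟩
    · have hr := (geodesicOf M).runsFromTo h₀ h₁
      convert hr using 1
      · rw [hminus, Horosphere.centre]
      · rw [Horosphere.centre, hplus, Pi.smul_apply, smul_eq_mul, smul_smul, mul_inv_rev,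
          mul_assoc, inv_mul_cancel₀ (Real.exp_pos _).ne', mul_one]
    · rw [hp₁']; simp [OrientedGeodesic.point, geodesicOf]
    · rw [hp₂', had.1]
    · rw [isComplexDistance_iff, ← hM, hout, mul_div_cancel_left₀ _ two_ne_zero]
      refine ⟨⟨0, ?_, ?_⟩, ⟨_, had⟩, rfl⟩ <;>
        simp [OrientedGeodesic.point, OrientedGeodesic.velocity, geodesicOf]
    · rw [mul_div_cancel_left₀ _ two_ne_zero, hexp]

/-- This is the determinant of the first columns of `A` and `B`, which right multiplication by
`upper` leaves unchanged. -/
theorem inv_mul_apply_one_zero (A B : SL2C) :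
    (A⁻¹ * B) 1 0 = A 0 0 * B 1 0 - A 1 0 * B 0 0 := by
  rw [Matrix.SpecialLinearGroup.coe_mul, Matrix.SpecialLinearGroup.coe_inv,
    Matrix.adjugate_fin_two, Matrix.mul_apply, Fin.sum_univ_two]
  simp
  ring

end SpinHorosphere

end

theorem theorem3 (Δ : SpinHorosphere.SpinDecoratedIdealTetrahedron) :
    ∃ lam : Fin 4 → Fin 4 → ℂ,
      (∀ i j : Fin 4, ∀ z : ℂ,
        SpinHorosphere.IsComplexLambdaLength (Δ.horosphere i) (Δ.horosphere j) z ↔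
          z = lam i j) ∧
      lam 0 1 * lam 2 3 + lam 0 3 * lam 1 2 = lam 0 2 * lam 1 3 := by
  choose A hn h₁ h₂ using fun i => (Δ.horosphere i).W.exists_outward_eq
  refine ⟨fun i j => ((A i)⁻¹ * A j) 1 0, fun i j => SpinHorosphere.isComplexLambdaLength_iff
    (hn i) (hn j) (h₁ i) (h₂ i) (h₁ j) (h₂ j), ?_⟩
  simp only [SpinHorosphere.inv_mul_apply_one_zero]
  -- The Plücker relation for the 2 by 2 minors of the matrix whose four columns are the spinors.
  ring
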